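/- A communication problem is a sequence $P=(P_N)_{N\in\mathbb N}$ of Boolean matrices $P_N\in\{0,1\}^{N\times N}$. Let $\mathsf{R}(M)$ be the minimum cost of a two-way public-coin randomized protocol that computes every entry of the matrix $M$ with success probability at least $2/3$. The class $\mathsf{BPP}^0$ consists of the problems $P$ for which there is a constant $c$ with $\mathsf{R}(P_N)\le c$ for all $N$. For a problem $Q$, let $\mathsf{QS}(Q)$ be the set of all matrices obtained from the matrices $Q_N$ by permuting, deleting and duplicating rows and columns. For a Boolean matrix $P$, let $\mathsf{D}^{Q}(P)$ be the minimum depth of a binary tree that computes $P$, where each inner node is labelled by a matrix in $\mathsf{QS}(Q)$ of the same dimensions as $P$, whose $(x,y)$ entry decides whether the input $(x,y)$ goes left or right, and each leaf is labelled by an output bit ($\mathsf{D}^{Q}(P)=\infty$ if there is no such tree). A problem $P$ reduces to $Q$ if there is a constant $c$ with $\mathsf{D}^{Q}(P_N)\le c$ for all $N$. A problem $Q$ is complete for a class $\mathcal C$ of problems if $Q\in\mathcal C$ and every $P\in\mathcal C$ reduces to $Q$. For $x,y\in\{0,1\}^n$ let $\mathsf{EHD}_k^n(x,y)=1$ if and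 only if the Hamming distance of $x$ and $y$ is exactly $k$, and $\mathsf{THD}_k^n(x,y)=1$ if and only if it is at most $k$. Theorem. (1) For every problem $Q\in\mathsf{BPP}^0$ there is a constant $k$ such that $\mathsf{D}^Q(\mathsf{EHD}_k^n)=\omega(1)$ and $\mathsf{D}^Q(\mathsf{THD}_k^n)=\omega(1)$ as $n\to\infty$. (2) There is no complete problem for $\mathsf{BPP}^0$. (3) For each $b\in\{0,1\}$, there is no complete problem for the class of problems with constant-cost one-sided-error public-coin randomized protocols, that is, protocols of cost bounded by a constant that are always correct on the entries with value $b$ and correct with probability at least $2/3$ on the entries with value $1-b$. -/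

import Mathlib

open scoped ENNReal
open Filter

namespace ConstantCost

/-- A communication problem: for every `N`, an `N × N` Boolean matrix. -/
abbrev CommProblem : Type := (N : ℕ) → Matrix (Fin N) (Fin N) Bool

/-- A square Boolean matrix of arbitrary finite size. -/
abbrev BoolMatrix : Type := Σ N : ℕ, Matrix (Fin N) (Fin N) Bool

/-- The set of Boolean matrices `{P_N : N ∈ ℕ}` that make up a communication problem. -/
def CommProblem.matrices (P : CommProblem) : Set BoolMatrix :=
  Set.range fun N => ⟨N, P N⟩

section Randomized

/-- A deterministic two-way protocol tree: at an inner node one of the two players sends a bit that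
depends on the input of that player; a leaf carries the output. -/
inductive Protocol (X Y : Type) : Type
  | leaf (b : Bool) : Protocol X Y
  | alice (f : X → Bool) (l r : Protocol X Y) : Protocol X Y
  | bob (g : Y → Bool) (l r : Protocol X Y) : Protocol X Y

/-- The output of a protocol on the input pair `(x, y)`. -/
def Protocol.eval {X Y : Type} : Protocol X Y → X → Y → Bool
  | .leaf b, _, _ => b
  | .alice f l r, x, y => if f x then r.eval x y else l.eval x y
  | .bob g l r, x, y => if g y then r.eval x y else l.eval x y

/-- The cost of a protocol: the largest number of bits sent on a path from the root to a leaf. -/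
def Protocol.cost {X Y : Type} : Protocol X Y → ℕ
  | .leaf _ => 0
  | .alice _ l r => max l.cost r.cost + 1
  | .bob _ l r => max l.cost r.cost + 1

/-- A public-coin randomized protocol is a probability distribution over deterministic protocols.
It has cost at most `c` if all protocols in its support do. -/
def CostAtMost {X Y : Type} (μ : PMF (Protocol X Y)) (c : ℕ) : Prop :=
  ∀ T ∈ μ.support, T.cost ≤ c

/-- The probability that the randomized protocol `μ` outputs `b` on the input pair `(x, y)`. -/
noncomputable def outputProb {X Y : Type} (μ : PMF (Protocol X Y)) (x : X) (y : Y) (b : Bool) :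
    ℝ≥0∞ :=
  μ.toOuterMeasure {T | T.eval x y = b}

/-- `μ` computes `M` with success probability at least `2/3` on every input pair. -/
def Computes {X Y : Type} (μ : PMF (Protocol X Y)) (M : Matrix X Y Bool) : Prop :=
  ∀ x y, 2 / 3 ≤ outputProb μ x y (M x y)

/-- `μ` computes `M` with one-sided error: it is always correct on the inputs where `M` has the
value `b`, and correct with probability at least `2/3` on the other ones. -/
def ComputesOneSided {X Y : Type} (b : Bool) (μ : PMF (Protocol X Y)) (M : Matrix X Y Bool) :
    Prop :=
  ∀ x y, (M x y = b → outputProb μ x y b = 1) ∧ (M x y = !b → 2 / 3 ≤ outputProb μ x y (!b))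

/-- `R(M)`: the minimum cost of a public-coin randomized protocol that computes `M` with success
probability at least `2/3`. -/
noncomputable def randCost {X Y : Type} (M : Matrix X Y Bool) : ℕ∞ :=
  ⨅ (c : ℕ) (_ : ∃ μ : PMF (Protocol X Y), CostAtMost μ c ∧ Computes μ M), (c : ℕ∞)

/-- The minimum cost of a public-coin randomized protocol that computes `M` with one-sided error,
always correctly on the inputs of value `b`. -/
noncomputable def oneSidedCost {X Y : Type} (b : Bool) (M : Matrix X Y Bool) : ℕ∞ :=
  ⨅ (c : ℕ) (_ : ∃ μ : PMF (Protocol X Y), CostAtMost μ c ∧ ComputesOneSided b μ M), (c : ℕ∞)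

/-- The class `BPP⁰` of problems of constant randomized cost. -/
def BPP0 : Set CommProblem :=
  {P | ∃ c : ℕ, ∀ N, randCost (P N) ≤ c}

/-- The class of problems of constant randomized cost with one-sided error, where no error is made
on the inputs of value `b`. -/
def OneSided0 (b : Bool) : Set CommProblem :=
  {P | ∃ c : ℕ, ∀ N, oneSidedCost b (P N) ≤ c}

end Randomized

section Oracle

/-- The query set `QS(𝓜)`: the matrices, with rows indexed by `X` and columns indexed by `Y`,
that arise from a matrix in `𝓜` by permuting, deleting and duplicating rows and columns.
Such a matrix is determined by saying which row (column) of the original matrix each of its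
rows (columns) is a copy of. -/
def QS (𝓜 : Set BoolMatrix) (X Y : Type) : Set (Matrix X Y Bool) :=
  {Q | ∃ A ∈ 𝓜, ∃ (r : X → Fin A.1) (c : Y → Fin A.1), Q = A.2.submatrix r c}

/-- A deterministic protocol with oracle access: a binary tree whose inner nodes are
labelled by query matrices from the set `S` and whose leaves are labelled by output bits. -/
inductive OracleProtocol {X Y : Type} (S : Set (Matrix X Y Bool)) : Type
  | leaf (b : Bool) : OracleProtocol S
  | query (Q : S) (l r : OracleProtocol S) : OracleProtocol S

/-- The output of an oracle protocol: at each inner node the entry `(x, y)` of the query matrix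
decides which way to go. -/
def OracleProtocol.eval {X Y : Type} {S : Set (Matrix X Y Bool)} :
    OracleProtocol S → X → Y → Bool
  | .leaf b, _, _ => b
  | .query Q l r, x, y => if Q.1 x y then r.eval x y else l.eval x y

/-- The cost of an oracle protocol: the largest number of queries on a path from the root to
a leaf. -/
def OracleProtocol.cost {X Y : Type} {S : Set (Matrix X Y Bool)} : OracleProtocol S → ℕ
  | .leaf _ => 0
  | .query _ l r => max l.cost r.cost + 1

/-- `D^𝓜(P)`: the minimum cost of a deterministic protocol with oracle access to `𝓜` that
computes `P` (`⊤` if there is none). -/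
noncomputable def oracleCost {X Y : Type} (𝓜 : Set BoolMatrix) (P : Matrix X Y Bool) : ℕ∞ :=
  ⨅ (T : OracleProtocol (QS 𝓜 X Y)) (_ : ∀ x y, T.eval x y = P x y), (T.cost : ℕ∞)

/-- `P` has a constant-cost reduction to `Q`: `D^Q(P) = O(1)`. -/
def ReducesTo (P Q : CommProblem) : Prop :=
  ∃ c : ℕ, ∀ N, oracleCost Q.matrices (P N) ≤ c

/-- `Q` is complete for the class `𝓒`: it belongs to `𝓒`, and all problems of `𝓒` have
constant-cost reductions to it. -/
def IsCompleteFor (𝓒 : Set CommProblem) (Q : CommProblem) : Prop :=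
  Q ∈ 𝓒 ∧ ∀ P ∈ 𝓒, ReducesTo P Q

end Oracle

/-- A sequence of costs is `ω(1)`: it eventually exceeds every constant. -/
def IsOmegaOne (u : ℕ → ℕ∞) : Prop :=
  ∀ c : ℕ, ∀ᶠ n in atTop, (c : ℕ∞) < u n

/-- Exact `k`-Hamming Distance on `n`-bit strings. -/
def EHD (k n : ℕ) : Matrix (Fin n → Bool) (Fin n → Bool) Bool :=
  Matrix.of fun x y => decide (hammingDist x y = k)

/-- Threshold `k`-Hamming Distance on `n`-bit strings. -/
def THD (k n : ℕ) : Matrix (Fin n → Bool) (Fin n → Bool) Bool :=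
  Matrix.of fun x y => decide (hammingDist x y ≤ k)

end ConstantCost

open ConstantCost

/-! The obstruction is the Greater-Than matrix. If `Q` has bounded randomized cost, its matrices
contain no Greater-Than matrix of some fixed size `t + 1`, nor the complement of one
(`not_hasStaircase_of_computes`). The functional `skew` sums, over all dyadic scales, the mean entry
above the diagonal minus the mean entry below it. On a Greater-Than matrix of size `2 ^ L` the
acceptance probabilities give at least `L / 3`. A rectangle contributes only `O(√L)`, because the
differences of its averages are paid for by increments of variance, and a protocol of cost `c` is a
sum of at most `2 ^ c` rectangles.

A matrix without such staircases cannot tell generic pairs of words at distance `t` from those at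
distance `t + 1` (`eventually_genericPair_succ_iff`), where "generic" refers to an iterated
ultrafilter limit. On a homogeneous set of slots `h 0 < ... < h t`, let row `i` have a private
symbol everywhere but at `h i`, and column `j` everywhere but at `h 0, ..., h j`. They agree at `h
i` if `i ≤ j` and differ in all these slots otherwise, so separating the two distances would produce
a staircase.

Truth along an ultrafilter commutes with Boolean connectives. Hence decision trees over these
matrices are equally blind, with the same `t` whatever their depth (`eventually_isStableComb_iff`).
One-hot encoding turns word distance `k` into Hamming distance `2 * k`, which gives the lower bounds
at `2 * t`. Hashing puts the threshold problem, suitably negated, into each one-sided class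
(`oneSidedCost_threshold_le`), so no class between a one-sided class and `BPP0` has a complete
problem. -/

namespace ConstantCost

/-! ### Randomized protocols and Greater-Than submatrices -/

section Staircase

/-- `Q` contains a Greater-Than matrix of size `t`, or the complement of one. -/
def HasStaircase {X Y : Type*} (t : ℕ) (Q : X → Y → Prop) : Prop :=
  ∃ (x : Fin t → X) (y : Fin t → Y),
    (∀ i j, Q (x i) (y j) ↔ i ≤ j) ∨ (∀ i j, Q (x i) (y j) ↔ ¬ i ≤ j)

/-- The average of `f` over the block `[s, s + 2 ^ L)`. -/
noncomputable def blockAvg (f : ℕ → ℝ) : ℕ → ℕ → ℝ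
  | 0, s => f s
  | L + 1, s => (blockAvg f L s + blockAvg f L (s + 2 ^ L)) / 2

/-- The variance of `f` on the block `[s, s + 2 ^ L)`. -/
noncomputable def blockVar (f : ℕ → ℝ) (L s : ℕ) : ℝ :=
  blockAvg (fun i => f i ^ 2) L s - blockAvg f L s ^ 2

/-- The average of the matrix `G` over a product of two blocks of length `2 ^ L`. -/
noncomputable def rectAvg (G : ℕ → ℕ → ℝ) (L s s' : ℕ) : ℝ :=
  blockAvg (fun i => blockAvg (G i) L s') L s

/-- The sum over all levels of the binary tree on `[s, s + 2 ^ L)` of the mean difference between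
the averages of `G` above and below the diagonal of a node. -/
noncomputable def skew (G : ℕ → ℕ → ℝ) : ℕ → ℕ → ℝ
  | 0, _ => 0
  | L + 1, s => (skew G L s + skew G L (s + 2 ^ L)) / 2 +
      (rectAvg G L s (s + 2 ^ L) - rectAvg G L (s + 2 ^ L) s)

lemma blockAvg_mono {f g : ℕ → ℝ} {L s : ℕ}
    (h : ∀ i, s ≤ i → i < s + 2 ^ L → f i ≤ g i) : blockAvg f L s ≤ blockAvg g L s := by
  induction L generalizing s with
  | zero => exact h s le_rfl (by simp)
  | succ L ih =>
    have h2 : 2 ^ (L + 1) = 2 ^ L + 2 ^ L := by ring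
    have h3 := ih (s := s) fun i hi hi' => h i hi (by omega)
    have h4 := ih (s := s + 2 ^ L) fun i hi hi' => h i (by omega) (by omega)
    simp only [blockAvg]
    linarith

lemma blockAvg_const (c : ℝ) (L s : ℕ) : blockAvg (fun _ => c) L s = c := by
  induction L generalizing s with
  | zero => rfl
  | succ L ih => simp [blockAvg, ih]

lemma blockAvg_add (f g : ℕ → ℝ) (L s : ℕ) :
    blockAvg (fun i => f i + g i) L s = blockAvg f L s + blockAvg g L s := by
  induction L generalizing s with
  | zero => rfl
  | succ L ih => simp only [blockAvg, ih]; ring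

lemma blockAvg_mul_const (f : ℕ → ℝ) (c : ℝ) (L s : ℕ) :
    blockAvg (fun i => f i * c) L s = blockAvg f L s * c := by
  induction L generalizing s with
  | zero => rfl
  | succ L ih => simp only [blockAvg, ih]; ring

lemma blockAvg_const_mul (f : ℕ → ℝ) (c : ℝ) (L s : ℕ) :
    blockAvg (fun i => c * f i) L s = c * blockAvg f L s := by
  simpa only [mul_comm c] using blockAvg_mul_const f c L s

lemma rectAvg_mul (f g : ℕ → ℝ) (L s s' : ℕ) :
    rectAvg (fun i j => f i * g j) L s s' = blockAvg f L s * blockAvg g L s' := by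
  simp only [rectAvg, blockAvg_const_mul, blockAvg_mul_const]

lemma rectAvg_add (F G : ℕ → ℕ → ℝ) (L s s' : ℕ) :
    rectAvg (fun i j => F i j + G i j) L s s' = rectAvg F L s s' + rectAvg G L s s' := by
  simp only [rectAvg, blockAvg_add]

lemma rectAvg_mono {F G : ℕ → ℕ → ℝ} {L s s' : ℕ}
    (h : ∀ i, s ≤ i → i < s + 2 ^ L → ∀ j, s' ≤ j → j < s' + 2 ^ L → F i j ≤ G i j) :
    rectAvg F L s s' ≤ rectAvg G L s s' :=
  blockAvg_mono fun i hi hi' => blockAvg_mono fun j hj hj' => h i hi hi' j hj hj'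

lemma rectAvg_const (c : ℝ) (L s s' : ℕ) : rectAvg (fun _ _ => c) L s s' = c := by
  simp only [rectAvg, blockAvg_const]

lemma skew_add (F G : ℕ → ℕ → ℝ) (L s : ℕ) :
    skew (fun i j => F i j + G i j) L s = skew F L s + skew G L s := by
  induction L generalizing s with
  | zero => simp [skew]
  | succ L ih => simp only [skew, ih, rectAvg_add]; ring

lemma blockAvg_mem_Icc {f : ℕ → ℝ} (h0 : ∀ i, 0 ≤ f i) (h1 : ∀ i, f i ≤ 1) (L s : ℕ) :
    0 ≤ blockAvg f L s ∧ blockAvg f L s ≤ 1 := by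
  have h2 := blockAvg_mono (L := L) (s := s) fun i _ _ => h0 i
  have h3 := blockAvg_mono (L := L) (s := s) fun i _ _ => h1 i
  rw [blockAvg_const] at h2 h3
  exact ⟨h2, h3⟩

lemma blockVar_le_one {f : ℕ → ℝ} (h0 : ∀ i, 0 ≤ f i) (h1 : ∀ i, f i ≤ 1) (L s : ℕ) :
    blockVar f L s ≤ 1 := by
  have h2 := (blockAvg_mem_Icc (f := fun i => f i ^ 2) (fun i => by positivity)
    (fun i => pow_le_one₀ (h0 i) (h1 i)) L s).2
  have h3 := sq_nonneg (blockAvg f L s)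
  unfold blockVar
  linarith

/-- The gap between the averages of the two halves is a gain of variance. As the variance never
exceeds 1, the squared gaps summed over all levels stay bounded. -/
lemma blockVar_succ (f : ℕ → ℝ) (L s : ℕ) :
    blockVar f (L + 1) s = (blockVar f L s + blockVar f L (s + 2 ^ L)) / 2 +
      ((blockAvg f L s - blockAvg f L (s + 2 ^ L)) / 2) ^ 2 := by
  simp only [blockVar, blockAvg]; ring

lemma abs_le_add_sq_div {η : ℝ} (hη : 0 < η) (u : ℝ) : |u| ≤ η + (u / 2) ^ 2 / η := by
  rw [← sub_le_iff_le_add', le_div_iff₀ hη]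
  nlinarith [sq_nonneg (|u| / 2 - η), sq_abs u]

/-- On a rectangle each level contributes `a * b' - a' * b`, which is at most `|a - a'| + |b - b'|`.
Linearizing with the parameter `η` charges `2 * η` to the level and the squares to the variance
increments. -/
lemma abs_skew_mul_le_var {f g : ℕ → ℝ} (hf0 : ∀ i, 0 ≤ f i) (hf1 : ∀ i, f i ≤ 1)
    (hg0 : ∀ i, 0 ≤ g i) (hg1 : ∀ i, g i ≤ 1) {η : ℝ} (hη : 0 < η) (L s : ℕ) :
    |skew (fun i j => f i * g j) L s| ≤
      2 * η * L + (blockVar f L s + blockVar g L s) / η := by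
  induction L generalizing s with
  | zero => simp [skew, blockVar, blockAvg]
  | succ L ih =>
    have h1 := ih s
    have h2 := ih (s + 2 ^ L)
    simp only [skew, rectAvg_mul, blockVar_succ]
    obtain ⟨ha0, ha1⟩ := blockAvg_mem_Icc hf0 hf1 L (s + 2 ^ L)
    obtain ⟨hb0, hb1⟩ := blockAvg_mem_Icc hg0 hg1 L (s + 2 ^ L)
    set a := blockAvg f L s
    set a' := blockAvg f L (s + 2 ^ L)
    set b := blockAvg g L s
    set b' := blockAvg g L (s + 2 ^ L)
    have h3 := abs_le_add_sq_div hη (a - a')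
    have h4 := abs_le_add_sq_div hη (b - b')
    have h5 : |a * b' - a' * b| ≤ |a - a'| + |b - b'| := by
      have : a * b' - a' * b = (a - a') * b' - a' * (b - b') := by ring
      rw [this]
      refine (abs_sub _ _).trans (add_le_add ?_ ?_)
      · rw [abs_mul, abs_of_nonneg hb0]
        exact mul_le_of_le_one_right (abs_nonneg _) hb1
      · rw [abs_mul, abs_of_nonneg ha0]
        exact mul_le_of_le_one_left (abs_nonneg _) ha1
    have h6 := abs_add_le ((skew (fun i j => f i * g j) L s +
      skew (fun i j => f i * g j) L (s + 2 ^ L)) / 2) (a * b' - a' * b)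
    have h7 := abs_add_le (skew (fun i j => f i * g j) L s)
      (skew (fun i j => f i * g j) L (s + 2 ^ L))
    rw [abs_div, abs_two] at h6
    push_cast
    have h8 : ((blockVar f L s + blockVar f L (s + 2 ^ L)) / 2 + ((a - a') / 2) ^ 2 +
        ((blockVar g L s + blockVar g L (s + 2 ^ L)) / 2 + ((b - b') / 2) ^ 2)) / η =
        ((blockVar f L s + blockVar g L s) / η +
          (blockVar f L (s + 2 ^ L) + blockVar g L (s + 2 ^ L)) / η) / 2 +
        ((a - a') / 2) ^ 2 / η + ((b - b') / 2) ^ 2 / η := by ring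
    rw [h8]
    linarith

lemma abs_skew_mul_le {f g : ℕ → ℝ} (hf0 : ∀ i, 0 ≤ f i) (hf1 : ∀ i, f i ≤ 1)
    (hg0 : ∀ i, 0 ≤ g i) (hg1 : ∀ i, g i ≤ 1) {η : ℝ} (hη : 0 < η) (L s : ℕ) :
    |skew (fun i j => f i * g j) L s| ≤ 2 * η * L + 2 / η := by
  refine (abs_skew_mul_le_var hf0 hf1 hg0 hg1 hη L s).trans ?_
  have h1 := blockVar_le_one hf0 hf1 L s
  have h2 := blockVar_le_one hg0 hg1 L s
  gcongr
  linarith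

/-- The functional `skew` is small on the restriction of a cheap protocol to a rectangle. -/
lemma abs_skew_protocol_le {X Y : Type} (x : ℕ → X) (y : ℕ → Y) (b : Bool) {η : ℝ} (hη : 0 < η)
    (L s : ℕ) (T : Protocol X Y) :
    ∀ {f g : ℕ → ℝ}, (∀ i, 0 ≤ f i) → (∀ i, f i ≤ 1) → (∀ i, 0 ≤ g i) → (∀ i, g i ≤ 1) →
    |skew (fun i j => f i * g j * if T.eval (x i) (y j) = b then 1 else 0) L s| ≤
      2 ^ T.cost * (2 * η * L + 2 / η) := by
  have hC : 0 ≤ 2 * η * L + 2 / η := by positivity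
  have hstep : ∀ l r : Protocol X Y, ∀ u v : ℝ,
      |u| ≤ 2 ^ l.cost * (2 * η * L + 2 / η) → |v| ≤ 2 ^ r.cost * (2 * η * L + 2 / η) →
      |u + v| ≤ 2 ^ (max l.cost r.cost + 1) * (2 * η * L + 2 / η) := by
    intro l r u v hu hv
    have h1 : (2 : ℝ) ^ l.cost ≤ 2 ^ max l.cost r.cost :=
      pow_le_pow_right₀ (by norm_num) (le_max_left _ _)
    have h2 : (2 : ℝ) ^ r.cost ≤ 2 ^ max l.cost r.cost :=
      pow_le_pow_right₀ (by norm_num) (le_max_right _ _)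
    have h3 := mul_le_mul_of_nonneg_right h1 hC
    have h4 := mul_le_mul_of_nonneg_right h2 hC
    have h5 := abs_add_le u v
    rw [pow_succ]
    linarith
  induction T with
  | leaf b' =>
    intro f g hf0 hf1 hg0 hg1
    by_cases h : b' = b
    · simpa [Protocol.eval, Protocol.cost, h] using abs_skew_mul_le hf0 hf1 hg0 hg1 hη L s
    · have := abs_skew_mul_le (f := fun _ => 0) (g := g) (by simp) (by simp) hg0 hg1 hη L s
      simpa [Protocol.eval, Protocol.cost, h] using this
  | alice p l r ihl ihr =>
    intro f g hf0 hf1 hg0 hg1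
    -- The message splits the weight `f` into two weights with sum `f`, one for each subtree.
    have h1 := ihl (f := fun i => if p (x i) then 0 else f i) (g := g)
      (fun i => by split_ifs <;> simp [hf0])
      (fun i => by split_ifs <;> simp [hf1]) hg0 hg1
    have h2 := ihr (f := fun i => if p (x i) then f i else 0) (g := g)
      (fun i => by split_ifs <;> simp [hf0])
      (fun i => by split_ifs <;> simp [hf1]) hg0 hg1
    have h3 := hstep l r _ _ h1 h2
    rw [← skew_add] at h3
    simp only [Protocol.cost]
    convert h3 using 3
    funext i j
    cases h : p (x i) <;> simp [Protocol.eval, h]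
  | bob p l r ihl ihr =>
    intro f g hf0 hf1 hg0 hg1
    have h1 := ihl (f := f) (g := fun i => if p (y i) then 0 else g i) hf0 hf1
      (fun i => by split_ifs <;> simp [hg0])
      (fun i => by split_ifs <;> simp [hg1])
    have h2 := ihr (f := f) (g := fun i => if p (y i) then g i else 0) hf0 hf1
      (fun i => by split_ifs <;> simp [hg0])
      (fun i => by split_ifs <;> simp [hg1])
    have h3 := hstep l r _ _ h1 h2
    rw [← skew_add] at h3
    simp only [Protocol.cost]
    convert h3 using 3
    funext i j
    cases h : p (y j) <;> simp [Protocol.eval, h]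

section Integral

open MeasureTheory

variable {Ω : Type*} [MeasurableSpace Ω] {μ : Measure Ω}

lemma integrable_blockAvg {F : Ω → ℕ → ℝ} (hF : ∀ i, Integrable (fun ω => F ω i) μ) (L s : ℕ) :
    Integrable (fun ω => blockAvg (F ω) L s) μ := by
  induction L generalizing s with
  | zero => exact hF s
  | succ L ih => exact ((ih s).add (ih _)).div_const 2

lemma integral_blockAvg {F : Ω → ℕ → ℝ} (hF : ∀ i, Integrable (fun ω => F ω i) μ) (L s : ℕ) :
    ∫ ω, blockAvg (F ω) L s ∂μ = blockAvg (fun i => ∫ ω, F ω i ∂μ) L s := by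
  induction L generalizing s with
  | zero => rfl
  | succ L ih =>
    simp only [blockAvg]
    rw [integral_div, integral_add (integrable_blockAvg hF L s) (integrable_blockAvg hF L _),
      ih, ih]

lemma integrable_rectAvg {F : Ω → ℕ → ℕ → ℝ} (hF : ∀ i j, Integrable (fun ω => F ω i j) μ)
    (L s s' : ℕ) : Integrable (fun ω => rectAvg (F ω) L s s') μ :=
  integrable_blockAvg (fun i => integrable_blockAvg (hF i) L s') L s

lemma integral_rectAvg {F : Ω → ℕ → ℕ → ℝ} (hF : ∀ i j, Integrable (fun ω => F ω i j) μ)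
    (L s s' : ℕ) :
    ∫ ω, rectAvg (F ω) L s s' ∂μ = rectAvg (fun i j => ∫ ω, F ω i j ∂μ) L s s' := by
  unfold rectAvg
  rw [integral_blockAvg fun i => integrable_blockAvg (hF i) L s']
  simp only [integral_blockAvg (hF _)]

lemma integrable_skew {F : Ω → ℕ → ℕ → ℝ} (hF : ∀ i j, Integrable (fun ω => F ω i j) μ)
    (L s : ℕ) : Integrable (fun ω => skew (F ω) L s) μ := by
  induction L generalizing s with
  | zero => exact integrable_zero _ _ _
  | succ L ih =>
    exact (((ih s).add (ih _)).div_const 2).add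
      ((integrable_rectAvg hF _ _ _).sub (integrable_rectAvg hF _ _ _))

lemma integral_skew {F : Ω → ℕ → ℕ → ℝ} (hF : ∀ i j, Integrable (fun ω => F ω i j) μ)
    (L s : ℕ) : ∫ ω, skew (F ω) L s ∂μ = skew (fun i j => ∫ ω, F ω i j ∂μ) L s := by
  induction L generalizing s with
  | zero => simp [skew]
  | succ L ih =>
    simp only [skew]
    rw [integral_add (f := fun ω => (skew (F ω) L s + skew (F ω) L (s + 2 ^ L)) / 2)
      (g := fun ω => rectAvg (F ω) L s (s + 2 ^ L) - rectAvg (F ω) L (s + 2 ^ L) s)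
      (((integrable_skew hF L s).add (integrable_skew hF L _)).div_const 2)
      ((integrable_rectAvg hF _ _ _).sub (integrable_rectAvg hF _ _ _)), integral_div,
      integral_add (integrable_skew hF L s) (integrable_skew hF L _),
      integral_sub (integrable_rectAvg hF _ _ _) (integrable_rectAvg hF _ _ _), ih, ih,
      integral_rectAvg hF, integral_rectAvg hF]

end Integral

/-- Every level gains `2 / 3 - 1 / 3`, since the two off-diagonal blocks of a node lie entirely on
opposite sides of the diagonal. -/
lemma le_skew {G : ℕ → ℕ → ℝ} {t : ℕ} (hle : ∀ i j, i ≤ j → j < t → 2 / 3 ≤ G i j)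
    (hlt : ∀ i j, j < i → i < t → G i j ≤ 1 / 3) (L s : ℕ) (hL : s + 2 ^ L ≤ t) :
    (L : ℝ) / 3 ≤ skew G L s := by
  induction L generalizing s with
  | zero => simp [skew]
  | succ L ih =>
    have h2 : 2 ^ (L + 1) = 2 ^ L + 2 ^ L := by ring
    have hpos : 0 < 2 ^ L := by positivity
    have h3 := ih s (by omega)
    have h4 := ih (s + 2 ^ L) (by omega)
    have h5 : (2 / 3 : ℝ) ≤ rectAvg G L s (s + 2 ^ L) := by
      rw [← rectAvg_const (2 / 3) L s (s + 2 ^ L)]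
      exact rectAvg_mono fun i hi hi' j hj hj' => hle i j (by omega) (by omega)
    have h6 : rectAvg G L (s + 2 ^ L) s ≤ 1 / 3 := by
      rw [← rectAvg_const (1 / 3) L (s + 2 ^ L) s]
      exact rectAvg_mono fun i hi hi' j hj hj' => hlt i j (by omega) (by omega)
    simp only [skew]
    push_cast
    linarith

/-- Every Greater-Than matrix in a matrix of randomized cost `c` has bounded size. -/
theorem not_hasStaircase_of_computes {X Y : Type} {M : Matrix X Y Bool} {c : ℕ}
    {μ : PMF (Protocol X Y)} (hc : CostAtMost μ c) (hμ : Computes μ M) :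
    ¬ HasStaircase (2 ^ (200 * 4 ^ c)) (fun x y => M x y = true) := by
  set L := 200 * 4 ^ c with hL
  rintro ⟨x₀, y₀, hxy⟩
  obtain ⟨b, hb⟩ : ∃ b : Bool, ∀ i j, M (x₀ i) (y₀ j) = if i ≤ j then b else !b := by
    rcases hxy with h | h
    · refine ⟨true, fun i j => ?_⟩
      have := h i j
      split_ifs with hij <;> simpa [hij] using this
    · refine ⟨false, fun i j => ?_⟩
      have := h i j
      split_ifs with hij <;> simpa [hij] using this
  have hpos : 0 < 2 ^ L := by positivity
  -- Reduction modulo `2 ^ L` only serves to index by all of `ℕ`; indices below `2 ^ L` are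
  -- unchanged.
  let x : ℕ → X := fun i => x₀ ⟨i % 2 ^ L, Nat.mod_lt _ hpos⟩
  let y : ℕ → Y := fun i => y₀ ⟨i % 2 ^ L, Nat.mod_lt _ hpos⟩
  have hM : ∀ i j, i < 2 ^ L → j < 2 ^ L → M (x i) (y j) = if i ≤ j then b else !b := by
    intro i j hi hj
    simp only [x, y, hb, Fin.mk_le_mk, Nat.mod_eq_of_lt hi, Nat.mod_eq_of_lt hj]
  let _ : MeasurableSpace (Protocol X Y) := ⊤
  have hms : ∀ S : Set (Protocol X Y), MeasurableSet S := fun _ => trivial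
  let F : Protocol X Y → ℕ → ℕ → ℝ := fun T i j => if T.eval (x i) (y j) = b then 1 else 0
  have hFi : ∀ i j, MeasureTheory.Integrable (fun T => F T i j) μ.toMeasure := fun i j =>
    MeasureTheory.Integrable.of_bound (C := 1) (measurable_from_top.aestronglyMeasurable)
      (Eventually.of_forall fun T => by simp only [F]; split_ifs <;> simp)
  have hFG : ∀ i j, ∫ T, F T i j ∂μ.toMeasure = (outputProb μ (x i) (y j) b).toReal := by
    intro i j
    have : (fun T => F T i j) = Set.indicator {T | T.eval (x i) (y j) = b} (fun _ => (1 : ℝ)) := by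
      ext T; simp [F, Set.indicator_apply]
    rw [this, MeasureTheory.integral_indicator_const _ (hms _), smul_eq_mul, mul_one,
      MeasureTheory.measureReal_def, PMF.toMeasure_apply_eq_toOuterMeasure_apply _ (hms _)]
    rfl
  have hsum : ∀ i j, (outputProb μ (x i) (y j) b).toReal +
      (outputProb μ (x i) (y j) (!b)).toReal = 1 := by
    intro i j
    have h2 := MeasureTheory.probReal_add_probReal_compl (μ := μ.toMeasure)
      (s := {T | T.eval (x i) (y j) = b}) (hms _)
    have h3 : {T : Protocol X Y | T.eval (x i) (y j) = b}ᶜ = {T | T.eval (x i) (y j) = !b} := by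
      ext T; cases b <;> simp
    rw [h3, MeasureTheory.measureReal_def, MeasureTheory.measureReal_def,
      PMF.toMeasure_apply_eq_toOuterMeasure_apply _ (hms _),
      PMF.toMeasure_apply_eq_toOuterMeasure_apply _ (hms _)] at h2
    exact h2
  have htop : ∀ i j b', outputProb μ (x i) (y j) b' ≠ ∞ := by
    intro i j b'
    unfold outputProb
    rw [← PMF.toMeasure_apply_eq_toOuterMeasure_apply _ (hms _)]
    exact MeasureTheory.measure_ne_top _ _
  have h23 : ∀ i j, (2 / 3 : ℝ) ≤ (outputProb μ (x i) (y j) (M (x i) (y j))).toReal := by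
    intro i j
    have := ENNReal.toReal_mono (htop i j _) (hμ (x i) (y j))
    simpa using this
  have hlow := le_skew (G := fun i j => ∫ T, F T i j ∂μ.toMeasure) (t := 2 ^ L)
    (fun i j hij hj => by
      have := h23 i j
      rw [hM i j (by omega) hj, if_pos hij] at this
      rw [hFG]; exact this)
    (fun i j hij hi => by
      have := h23 i j
      rw [hM i j hi (by omega), if_neg (by omega)] at this
      have := hsum i j
      rw [hFG]; linarith) L 0 (by omega)
  -- With this `η` the upper bound is `L / 12 + 48 * 4 ^ c`. It is below `L / 3` because `L / 4 = 50
  -- * 4 ^ c`.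
  have hη : (0 : ℝ) < 1 / (24 * 2 ^ c) := by positivity
  set η : ℝ := 1 / (24 * 2 ^ c) with hηdef
  rw [← integral_skew hFi] at hlow
  have hup : ∫ T, skew (F T) L 0 ∂μ.toMeasure ≤
      ∫ _, 2 ^ c * (2 * η * L + 2 / η) ∂μ.toMeasure := by
    refine MeasureTheory.integral_mono_ae (integrable_skew hFi L 0)
      (MeasureTheory.integrable_const _) ?_
    have hsupp : ∀ᵐ T ∂μ.toMeasure, T ∈ μ.support := by
      rw [MeasureTheory.ae_iff, PMF.toMeasure_apply_eq_zero_iff _ (hms _)]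
      exact Set.disjoint_left.2 fun T h h' => h' h
    filter_upwards [hsupp] with T hT
    have h1 := abs_skew_protocol_le x y b hη L 0 T (f := fun _ => 1) (g := fun _ => 1)
      (by simp) (by simp) (by simp) (by simp)
    simp only [one_mul] at h1
    refine ((le_abs_self _).trans h1).trans ?_
    gcongr
    · norm_num
    · exact hc T hT
  simp only [MeasureTheory.integral_const, MeasureTheory.probReal_univ, one_smul] at hup
  have h1 : (2 : ℝ) ^ c * (2 * η * L + 2 / η) = L / 12 + 48 * (2 ^ c * 2 ^ c) := by
    rw [hηdef]; field_simp; ring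
  have h2 : (L : ℝ) = 200 * (2 ^ c * 2 ^ c) := by
    rw [hL, ← mul_pow]; norm_num
  rw [h1] at hup
  have h3 : (0 : ℝ) < 2 ^ c * 2 ^ c := by positivity
  linarith

end Staircase

/-! ### Generic pairs of words along iterated ultrafilters -/

section Generic

/-- Almost every point has the generic truth value. Intersecting finitely many such events yields
one point that is typical for finitely many properties, which replaces Ramsey arguments throughout.
-/
lemma eventually_iff_eventually {α : Type*} (f : Ultrafilter α) (p : α → Prop) :
    ∀ᶠ a in f, (p a ↔ ∀ᶠ b in f, p b) := by
  rcases f.em p with h | h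
  · filter_upwards [h] with a ha using by simp [ha, h]
  · have h' := Ultrafilter.eventually_not.1 h
    filter_upwards [h] with a ha using by simp [ha, h']

lemma hyperfilter_eventually_ne (a : ℕ) : ∀ᶠ b in (hyperfilter ℕ : Filter ℕ), b ≠ a :=
  compl_mem_hyperfilter_of_finite (Set.finite_singleton a)

/-- Pairs of infinite words over the alphabet `ℕ`. -/
abbrev WordPair : Type := (ℕ → ℕ) × (ℕ → ℕ)

/-- Prepend a term to a sequence. -/
def seqCons (a : ℕ) (x : ℕ → ℕ) : ℕ → ℕ
  | 0 => a
  | s + 1 => x s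

/-- The iterated ultrafilter limit on pairs of words with slots `s < r`: a slot with `d s = true`
gets two independent generic symbols, the other ones a common generic symbol. -/
noncomputable def wordU : (ℕ → Bool) → ℕ → Ultrafilter (WordPair)
  | _, 0 => pure (0, 0)
  | d, r + 1 =>
    if d 0 then
      (hyperfilter ℕ).bind fun a => (hyperfilter ℕ).bind fun b =>
        (wordU (fun s => d (s + 1)) r).map fun p => (seqCons a p.1, seqCons b p.2)
    else
      (hyperfilter ℕ).bind fun a =>
        (wordU (fun s => d (s + 1)) r).map fun p => (seqCons a p.1, seqCons a p.2)

lemma eventually_wordU_zero {d : ℕ → Bool} {p : WordPair → Prop} :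
    (∀ᶠ z : WordPair in wordU d 0, p z) ↔ p (0, 0) := Iff.rfl

lemma eventually_wordU_succ_of_true {d : ℕ → Bool} {r : ℕ} (hd : d 0 = true)
    {p : WordPair → Prop} :
    (∀ᶠ z : WordPair in wordU d (r + 1), p z) ↔ ∀ᶠ a in hyperfilter ℕ, ∀ᶠ b in hyperfilter ℕ,
      ∀ᶠ z : WordPair in wordU (fun s => d (s + 1)) r, p (seqCons a z.1, seqCons b z.2) := by
  rw [wordU, if_pos hd]
  exact Iff.rfl

lemma eventually_wordU_succ_of_false {d : ℕ → Bool} {r : ℕ} (hd : d 0 = false)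
    {p : WordPair → Prop} :
    (∀ᶠ z : WordPair in wordU d (r + 1), p z) ↔ ∀ᶠ a in hyperfilter ℕ,
      ∀ᶠ z : WordPair in wordU (fun s => d (s + 1)) r, p (seqCons a z.1, seqCons a z.2) := by
  rw [wordU, if_neg (by simp [hd])]
  exact Iff.rfl

lemma eventually_wordU_ne_iff (d : ℕ → Bool) (r : ℕ) :
    ∀ᶠ z : WordPair in wordU d r, ∀ s, z.1 s ≠ z.2 s ↔ s < r ∧ d s = true := by
  induction r generalizing d with
  | zero => rw [eventually_wordU_zero]; simp
  | succ r ih =>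
    cases hd : d 0
    · rw [eventually_wordU_succ_of_false hd]
      refine Eventually.of_forall fun a => ?_
      filter_upwards [ih fun s => d (s + 1)] with z hz s
      cases s with
      | zero => simp [seqCons, hd]
      | succ s => simpa [seqCons] using hz s
    · rw [eventually_wordU_succ_of_true hd]
      refine Eventually.of_forall fun a => ?_
      filter_upwards [hyperfilter_eventually_ne a] with b hb
      filter_upwards [ih fun s => d (s + 1)] with z hz s
      cases s with
      | zero => simpa [seqCons, hd] using hb.symm
      | succ s => simpa [seqCons] using hz s

/-- Finitely many generic properties of pairs of words can be realized simultaneously, as long as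
the patterns arise from a choice, for every row and every column, of the slots with a private
symbol. -/
lemma exists_words {ι κ : Type*} [Finite ι] [Finite κ] (r : ℕ) (ε : ι → ℕ → Bool)
    (δ : κ → ℕ → Bool) (Q : ι → κ → (ℕ → ℕ) → (ℕ → ℕ) → Prop)
    (h : ∀ i j, ∀ᶠ z : WordPair in wordU (fun s => ε i s || δ j s) r, Q i j z.1 z.2) :
    ∃ (x : ι → ℕ → ℕ) (y : κ → ℕ → ℕ), ∀ i j, Q i j (x i) (y j) := by
  induction r generalizing ε δ Q with
  | zero => exact ⟨fun _ => 0, fun _ => 0, fun i j => h i j⟩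
  | succ r ih =>
    -- Here `a` is the private symbol of the rows, `c` the shared one and `b` that of the columns.
    -- The pairs that occur are `(a, b)`, `(a, c)`, `(c, b)` and `(c, c)`. Drawing `c` between `a`
    -- and `b` always puts the row symbol first, as `wordU` requires.
    have key : ∀ᶠ a in (hyperfilter ℕ : Filter ℕ), ∀ᶠ c in (hyperfilter ℕ : Filter ℕ),
        ∀ᶠ b in (hyperfilter ℕ : Filter ℕ), ∀ i j,
        ∀ᶠ z : WordPair in wordU (fun s => ε i (s + 1) || δ j (s + 1)) r,
          Q i j (seqCons (if ε i 0 then a else c) z.1) (seqCons (if δ j 0 then b else c) z.2) := by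
      simp only [eventually_all]
      intro i j
      have h' := h i j
      cases hε : ε i 0 <;> cases hδ : δ j 0
      · rw [eventually_wordU_succ_of_false (by simp [hε, hδ])] at h'
        exact Eventually.of_forall fun a => h'.mono fun c hc => Eventually.of_forall fun b => hc
      · rw [eventually_wordU_succ_of_true (by simp [hε, hδ])] at h'
        exact Eventually.of_forall fun a => h'
      · rw [eventually_wordU_succ_of_true (by simp [hε, hδ])] at h'
        exact h'.mono fun a ha => ha.mono fun c hc => Eventually.of_forall fun b => hc
      · rw [eventually_wordU_succ_of_true (by simp [hε, hδ])] at h'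
        exact h'.mono fun a ha => Eventually.of_forall fun c => ha
    obtain ⟨a, ha⟩ := key.exists
    obtain ⟨c, hc⟩ := ha.exists
    obtain ⟨b, hb⟩ := hc.exists
    obtain ⟨x, y, hxy⟩ := ih (fun i s => ε i (s + 1)) (fun j s => δ j (s + 1))
      (fun i j x y => Q i j (seqCons (if ε i 0 then a else c) x)
        (seqCons (if δ j 0 then b else c) y)) hb
    exact ⟨_, _, hxy⟩

/-- The ultrafilter of generic `k`-element sets of natural numbers. -/
noncomputable def subsetU : ℕ → Ultrafilter (Finset ℕ)
  | 0 => pure ∅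
  | k + 1 => (hyperfilter ℕ).bind fun h => (subsetU k).map (insert h)

lemma eventually_subsetU_zero {p : Finset ℕ → Prop} : (∀ᶠ I : Finset ℕ in subsetU 0, p I) ↔ p ∅ := Iff.rfl

lemma eventually_subsetU_succ {k : ℕ} {p : Finset ℕ → Prop} :
    (∀ᶠ I : Finset ℕ in subsetU (k + 1), p I) ↔
      ∀ᶠ h in hyperfilter ℕ, ∀ᶠ I : Finset ℕ in subsetU k, p (insert h I) := Iff.rfl

lemma eventually_subsetU_notMem (a k : ℕ) : ∀ᶠ I : Finset ℕ in subsetU k, a ∉ I := by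
  induction k with
  | zero => rw [eventually_subsetU_zero]; simp
  | succ k ih =>
    rw [eventually_subsetU_succ]
    filter_upwards [hyperfilter_eventually_ne a] with h hh
    filter_upwards [ih] with I hI
    simp [hI, hh.symm]

lemma eventually_subsetU_card (k : ℕ) : ∀ᶠ I : Finset ℕ in subsetU k, I.card = k := by
  induction k with
  | zero => rw [eventually_subsetU_zero]; simp
  | succ k ih =>
    rw [eventually_subsetU_succ]
    refine Eventually.of_forall fun h => ?_
    filter_upwards [ih, eventually_subsetU_notMem h k] with I hI hn
    rw [Finset.card_insert_of_notMem hn, hI]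

/-- The set is built one element at a time, each typical for all the finitely many conditions left
by the earlier ones. The budget `T` bounds the number `k` of generic elements still to be added,
which keeps these conditions finite in number; each new element uses up one. -/
lemma exists_homogeneous_aux (v : Finset ℕ → Prop) (T m : ℕ) (hm : m ≤ T) :
    ∃ H : Finset ℕ, H.card = m ∧ ∀ I ⊆ H, ∀ k, k + m ≤ T →
      ((∀ᶠ J : Finset ℕ in subsetU k, v (I ∪ J)) ↔ ∀ᶠ J : Finset ℕ in subsetU (I.card + k), v J) := by
  induction m with
  | zero =>
    refine ⟨∅, rfl, fun I hI k _ => ?_⟩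
    obtain rfl := Finset.subset_empty.1 hI
    simp
  | succ m ih =>
    obtain ⟨H, hH, hv⟩ := ih (by omega)
    have h1 : ∀ᶠ h in (hyperfilter ℕ : Filter ℕ), ∀ I ∈ H.powerset, ∀ k ∈ Finset.range T,
        ((∀ᶠ J : Finset ℕ in subsetU k, v (I ∪ insert h J)) ↔ ∀ᶠ J : Finset ℕ in subsetU (k + 1), v (I ∪ J)) := by
      simp only [Filter.eventually_all_finset]
      intro I _ k _
      simp only [eventually_subsetU_succ]
      exact eventually_iff_eventually _ _
    have h2 : ∀ᶠ h in (hyperfilter ℕ : Filter ℕ), h ∉ H :=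
      compl_mem_hyperfilter_of_finite H.finite_toSet
    obtain ⟨h, hh1, hh2⟩ := (h1.and h2).exists
    refine ⟨insert h H, by rw [Finset.card_insert_of_notMem hh2, hH], fun I hI k hk => ?_⟩
    by_cases hhI : h ∈ I
    · have hsub : I.erase h ⊆ H := Finset.subset_insert_iff.1 hI
      have h3 := hh1 (I.erase h) (Finset.mem_powerset.2 hsub) k
        (Finset.mem_range.2 (by omega))
      have h4 := hv _ hsub (k + 1) (by omega)
      have h5 : (I.erase h).card + 1 = I.card := Finset.card_erase_add_one hhI
      rw [show (I.erase h).card + (k + 1) = I.card + k by omega] at h4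
      rw [← h4, ← h3]
      refine eventually_congr (Eventually.of_forall fun J => ?_)
      rw [Finset.union_insert, ← Finset.insert_union, Finset.insert_erase hhI]
    · exact hv I ((Finset.subset_insert_iff_of_notMem hhI).1 hI) k (by omega)

/-- A finite form of Ramsey's theorem: all subsets of `H` are generic for `v`. -/
lemma exists_homogeneous (v : Finset ℕ → Prop) (t : ℕ) :
    ∃ H : Finset ℕ, H.card = t ∧ ∀ I ⊆ H, (v I ↔ ∀ᶠ J : Finset ℕ in subsetU I.card, v J) := by
  obtain ⟨H, hH, hv⟩ := exists_homogeneous_aux v t t le_rfl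
  refine ⟨H, hH, fun I hI => ?_⟩
  have := hv I hI 0 (by omega)
  rw [eventually_subsetU_zero] at this
  simpa using this

/-- The ultrafilter of generic pairs of words that differ in `k` slots. -/
noncomputable def genericPair (k : ℕ) : Ultrafilter (WordPair) :=
  (subsetU k).bind fun I => (hyperfilter ℕ).bind fun r => wordU (fun s => decide (s ∈ I)) r

lemma eventually_genericPair {k : ℕ} {p : WordPair → Prop} :
    (∀ᶠ z : WordPair in genericPair k, p z) ↔ ∀ᶠ I : Finset ℕ in subsetU k, ∀ᶠ r in hyperfilter ℕ,
      ∀ᶠ z : WordPair in wordU (fun s => decide (s ∈ I)) r, p z := Iff.rfl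

lemma eventually_genericPair_ne_iff (k : ℕ) :
    ∀ᶠ z : WordPair in genericPair k, ∃ D : Finset ℕ, D.card = k ∧ ∀ s, z.1 s ≠ z.2 s ↔ s ∈ D := by
  rw [eventually_genericPair]
  filter_upwards [eventually_subsetU_card k] with I hI
  have h1 : ∀ᶠ r in (hyperfilter ℕ : Filter ℕ), I.sup id < r :=
    Nat.hyperfilter_le_atTop (eventually_gt_atTop _)
  filter_upwards [h1] with r hr
  filter_upwards [eventually_wordU_ne_iff (fun s => decide (s ∈ I)) r] with z hz
  refine ⟨I, hI, fun s => (hz s).trans ?_⟩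
  simp only [decide_eq_true_eq, and_iff_right_iff_imp]
  exact fun hs => (Finset.le_sup (f := id) hs).trans_lt hr

/-- A matrix without large Greater-Than submatrices does not distinguish generic pairs at distance
`t` from generic pairs at distance `t + 1`. -/
theorem eventually_genericPair_succ_iff {t : ℕ} {Q : (ℕ → ℕ) → (ℕ → ℕ) → Prop}
    (hQ : ¬ HasStaircase (t + 1) Q) :
    (∀ᶠ z : WordPair in genericPair (t + 1), Q z.1 z.2) ↔ ∀ᶠ z : WordPair in genericPair t, Q z.1 z.2 := by
  by_contra hne
  let v : Finset ℕ → Prop := fun I => ∀ᶠ r in hyperfilter ℕ,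
    ∀ᶠ z : WordPair in wordU (fun s => decide (s ∈ I)) r, Q z.1 z.2
  obtain ⟨H, hH, hv⟩ := exists_homogeneous v (t + 1)
  let h := H.orderEmbOfFin hH
  have hmem : ∀ i, h i ∈ H := H.orderEmbOfFin_mem hH
  -- The set of slots where row `i` and column `j` are to differ: of size `t` if `i ≤ j`, and `t +
  -- 1` otherwise.
  let A : Fin (t + 1) → Fin (t + 1) → Finset ℕ := fun i j => if i ≤ j then H.erase (h i) else H
  have hA : ∀ i j, v (A i j) ↔ (i ≤ j ↔ ∀ᶠ z : WordPair in genericPair t, Q z.1 z.2) := by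
    intro i j
    by_cases hij : i ≤ j
    · have h1 := hv (H.erase (h i)) (Finset.erase_subset _ _)
      rw [Finset.card_erase_of_mem (hmem i), hH] at h1
      simp only [A, hij, if_true, true_iff]
      exact h1
    · have h1 := hv H subset_rfl
      rw [hH] at h1
      have h2 : v H ↔ ∀ᶠ z : WordPair in genericPair (t + 1), Q z.1 z.2 := h1
      simp only [A, hij, if_false, false_iff]
      tauto
  -- A single word length has to be typical for all pairs `i`, `j` at once.
  have hr : ∀ᶠ r in (hyperfilter ℕ : Filter ℕ), ∀ i j,
      (∀ᶠ z : WordPair in wordU (fun s => decide (s ∈ A i j)) r, Q z.1 z.2) ↔ v (A i j) := by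
    simp only [eventually_all]
    exact fun i j => eventually_iff_eventually _ _
  obtain ⟨r, hr⟩ := hr.exists
  -- A slot differs as soon as one side has a private symbol there, so the slots of `H` on which the
  -- words agree are `{h i} ∩ {h l | l ≤ j}`.
  obtain ⟨x, y, hxy⟩ := exists_words r (fun i s => decide (s ∈ H ∧ s ≠ h i))
    (fun j s => decide (s ∈ H ∧ ∀ l ≤ j, s ≠ h l)) (fun i j x y => Q x y ↔ v (A i j))
    (by
      intro i j
      have h1 : (fun s => decide (s ∈ H ∧ s ≠ h i) || decide (s ∈ H ∧ ∀ l ≤ j, s ≠ h l)) =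
          fun s => decide (s ∈ A i j) := by
        funext s
        rw [← Bool.decide_or]
        refine decide_eq_decide.2 ?_
        by_cases hij : i ≤ j
        · simp only [A, hij, if_true, Finset.mem_erase]
          constructor
          · rintro (⟨h1, h2⟩ | ⟨h1, h2⟩)
            · exact ⟨h2, h1⟩
            · exact ⟨h2 i hij, h1⟩
          · exact fun h1 => Or.inl ⟨h1.2, h1.1⟩
        · simp only [A, hij, if_false]
          constructor
          · rintro (h1 | h1) <;> exact h1.1
          · intro h1
            by_cases h2 : s = h i
            · exact Or.inr ⟨h1, fun l hl hs => hij (h.injective (h2.symm.trans hs) ▸ hl)⟩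
            · exact Or.inl ⟨h1, h2⟩
      rw [h1]
      simp only [← hr i j]
      exact eventually_iff_eventually _ _)
  refine hQ ⟨x, y, ?_⟩
  by_cases hP : ∀ᶠ z : WordPair in genericPair t, Q z.1 z.2
  · exact Or.inl fun i j => by rw [hxy, hA]; simp only [hP, iff_true]
  · exact Or.inr fun i j => by rw [hxy, hA]; simp only [hP, iff_false]

end Generic

/-! ### From words to bit strings, and the lower bound -/

section Encoding

/-- The one-hot encoding of a word, cut off after `n` bits. -/
def oneHot (n : ℕ) (x : ℕ → ℕ) : Fin n → Bool :=
  fun i => decide (x (Nat.unpair i).1 = (Nat.unpair i).2)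

lemma eventually_hammingDist_oneHot {x y : ℕ → ℕ} {D : Finset ℕ}
    (hD : ∀ s, x s ≠ y s ↔ s ∈ D) :
    ∀ᶠ n in atTop, hammingDist (oneHot n x) (oneHot n y) = 2 * D.card := by
  -- Each slot in `D` accounts for two differing bits: the one set only by `x` and the one set only
  -- by `y`.
  let S : Finset ℕ := D.image (fun s => Nat.pair s (x s)) ∪ D.image (fun s => Nat.pair s (y s))
  have hS : S.card = 2 * D.card := by
    rw [Finset.card_union_of_disjoint, Finset.card_image_of_injective, Finset.card_image_of_injective,
      two_mul]
    · exact fun a b hab => (Nat.pair_eq_pair.1 hab).1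
    · exact fun a b hab => (Nat.pair_eq_pair.1 hab).1
    · rw [Finset.disjoint_left]
      simp only [Finset.mem_image, not_exists, not_and]
      rintro _ ⟨s, hs, rfl⟩ s' hs' h
      obtain ⟨rfl, h⟩ := Nat.pair_eq_pair.1 h
      exact (hD _).2 hs h.symm
  filter_upwards [eventually_gt_atTop (S.sup id)] with n hn
  rw [← hS, hammingDist, ← Finset.card_map Fin.valEmbedding]
  congr 1
  ext i
  simp only [Finset.mem_map, Finset.mem_filter, Finset.mem_univ, true_and, Fin.valEmbedding_apply]
  have hiS : i ∈ S ↔ ((x (Nat.unpair i).1 = (Nat.unpair i).2) ↔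
      ¬ (y (Nat.unpair i).1 = (Nat.unpair i).2)) := by
    have h1 : ∀ z : ℕ → ℕ, (∃ s ∈ D, Nat.pair s (z s) = i) ↔
        (Nat.unpair i).1 ∈ D ∧ z (Nat.unpair i).1 = (Nat.unpair i).2 := by
      intro z
      constructor
      · rintro ⟨s, hs, rfl⟩
        simpa using hs
      · rintro ⟨h1, h2⟩
        exact ⟨_, h1, by rw [h2, Nat.pair_unpair]⟩
    simp only [S, Finset.mem_union, Finset.mem_image]
    rw [h1, h1, ← hD]
    clear h1 hS hn
    grind
  constructor
  · rintro ⟨j, hj, rfl⟩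
    rw [hiS]
    simp only [oneHot, ne_eq, decide_eq_decide] at hj
    tauto
  · intro hi
    refine ⟨⟨i, (Finset.le_sup (f := id) hi).trans_lt hn⟩, ?_, rfl⟩
    simp only [oneHot, ne_eq, decide_eq_decide]
    rw [hiS] at hi
    tauto

/-- `M` is computed by a decision tree of depth at most `c` over matrices that do not contain
Greater-Than matrices of size `t`. -/
def IsStableComb {X Y : Type} (t : ℕ) : ℕ → (X → Y → Bool) → Prop
  | 0, M => ∃ b, ∀ x y, M x y = b
  | c + 1, M => ∃ Q l r : X → Y → Bool, ¬ HasStaircase t (fun x y => Q x y = true) ∧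
      IsStableComb t c l ∧ IsStableComb t c r ∧ ∀ x y, M x y = if Q x y then r x y else l x y

/-- Shallow leaves are padded to exact depth by a constant query. This needs `2 ≤ t`, as a constant
matrix contains a staircase of size 1. -/
lemma isStableComb_const {X Y : Type} {t : ℕ} (ht : 2 ≤ t) (c : ℕ) (b : Bool) :
    IsStableComb t c (fun (_ : X) (_ : Y) => b) := by
  induction c with
  | zero => exact ⟨b, fun _ _ => rfl⟩
  | succ c ih =>
    refine ⟨fun _ _ => false, _, _, ?_, ih, ih, fun _ _ => rfl⟩
    rintro ⟨x, y, h | h⟩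
    · simpa using h ⟨0, by omega⟩ ⟨0, by omega⟩
    · have := h ⟨1, by omega⟩ ⟨0, by omega⟩
      simp at this

lemma isStableComb_oracleProtocol {X Y : Type} {t : ℕ} (ht : 2 ≤ t) {𝓜 : Set BoolMatrix}
    (h𝓜 : ∀ Q ∈ QS 𝓜 X Y, ¬ HasStaircase t (fun x y => Q x y = true)) (c : ℕ)
    (T : OracleProtocol (QS 𝓜 X Y)) (hT : T.cost ≤ c) :
    IsStableComb t c T.eval := by
  induction T generalizing c with
  | leaf b => exact isStableComb_const ht c b
  | query Q l r ihl ihr =>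
    simp only [OracleProtocol.cost] at hT
    obtain ⟨c, rfl⟩ : ∃ c', c = c' + 1 := ⟨c - 1, by omega⟩
    exact ⟨Q.1, l.eval, r.eval, h𝓜 _ Q.2, ihl c (by omega), ihr c (by omega), fun _ _ => rfl⟩

/-- The limit of stable matrices is stable. -/
lemma not_hasStaircase_limit {t : ℕ} (V : Ultrafilter ℕ) {X Y : ℕ → Type} {Z W : Type}
    (Q : ∀ n, X n → Y n → Prop) (hQ : ∀ n, ¬ HasStaircase t (Q n))
    (e : ∀ n, Z → X n) (f : ∀ n, W → Y n) :
    ¬ HasStaircase t (fun x y => ∀ᶠ n in V, Q n (e n x) (f n y)) := by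
  rintro ⟨x, y, h⟩
  have h1 : ∀ᶠ n in V, ∀ i j, Q n (e n (x i)) (f n (y j)) ↔
      ∀ᶠ n in V, Q n (e n (x i)) (f n (y j)) := by
    simp only [eventually_all]
    exact fun i j => eventually_iff_eventually _ _
  obtain ⟨n, hn⟩ := h1.exists
  refine hQ n ⟨fun i => e n (x i), fun j => f n (y j), ?_⟩
  exact h.imp (fun h i j => (hn i j).trans (h i j)) fun h i j => (hn i j).trans (h i j)

/-- The root query passes to the limit over `n` as a single matrix without staircases. The generic
value of the tree is then a Boolean combination of the generic values of the query and the subtrees,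
so `t` need not grow with `c`. -/
theorem eventually_isStableComb_iff {t c : ℕ} (V : Ultrafilter ℕ)
    (M : ∀ n, (Fin n → Bool) → (Fin n → Bool) → Bool)
    (hM : ∀ n, IsStableComb (t + 1) c (M n)) :
    (∀ᶠ z : WordPair in genericPair (t + 1), ∀ᶠ n in V, M n (oneHot n z.1) (oneHot n z.2) = true) ↔
      ∀ᶠ z : WordPair in genericPair t, ∀ᶠ n in V, M n (oneHot n z.1) (oneHot n z.2) = true := by
  induction c generalizing M with
  | zero =>
    choose b hb using hM
    simp only [hb, eventually_const]
  | succ c ih =>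
    choose Q l r hQ hl hr hM using hM
    have h1 := eventually_genericPair_succ_iff (t := t)
      (not_hasStaircase_limit V (fun n x y => Q n x y = true) hQ oneHot oneHot)
    have h2 : ∀ n x y, M n x y = true ↔ (Q n x y = true ∧ r n x y = true) ∨
        (¬ Q n x y = true ∧ l n x y = true) := by
      intro n x y
      rw [hM]
      split_ifs with h <;> simp [h]
    simp only [h2, Ultrafilter.eventually_or, Filter.eventually_and, Ultrafilter.eventually_not,
      ih l hl, ih r hr, h1]

lemma eventually_genericPair_hammingDist (k : ℕ) :
    ∀ᶠ z : WordPair in genericPair k, ∀ᶠ n in atTop,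
      hammingDist (oneHot n z.1) (oneHot n z.2) = 2 * k := by
  filter_upwards [eventually_genericPair_ne_iff k] with z hz
  obtain ⟨D, rfl, hD⟩ := hz
  exact eventually_hammingDist_oneHot hD

/-- A function of the Hamming distance that separates the values `2 * t` and `2 * (t + 1)` has
large cost relative to oracles without Greater-Than matrices of size `t + 1`. -/
theorem isOmegaOne_oracleCost_of_not_hasStaircase {t : ℕ} (ht : 1 ≤ t) {𝓜 : Set BoolMatrix}
    (h𝓜 : ∀ A ∈ 𝓜, ¬ HasStaircase (t + 1) (fun x y => A.2 x y = true))
    (f : ℕ → Bool) (hf : f (2 * t) ≠ f (2 * (t + 1))) :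
    IsOmegaOne fun n => oracleCost 𝓜
      (Matrix.of fun x y : Fin n → Bool => f (hammingDist x y)) := by
  intro c
  by_contra hc
  have hQS : ∀ X Y : Type, ∀ Q ∈ QS 𝓜 X Y,
      ¬ HasStaircase (t + 1) (fun x y => Q x y = true) := by
    rintro X Y _ ⟨A, hA, r, s, rfl⟩ ⟨x, y, h⟩
    exact h𝓜 A hA ⟨fun i => r (x i), fun j => s (y j), h⟩
  rw [not_eventually] at hc
  have hne : (atTop ⊓ 𝓟 {n | ¬ ((c : ℕ∞) < oracleCost 𝓜
      (Matrix.of fun x y : Fin n → Bool => f (hammingDist x y)))}).NeBot :=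
    frequently_mem_iff_neBot.1 hc
  -- `V` lives on the infinitely many `n` of cost at most `c`; for the other `n` any stable matrix
  -- will do below.
  obtain ⟨V, hV⟩ := Ultrafilter.exists_le (atTop ⊓ 𝓟 {n | ¬ ((c : ℕ∞) < oracleCost 𝓜
    (Matrix.of fun x y : Fin n → Bool => f (hammingDist x y)))})
  have hVtop : (V : Filter ℕ) ≤ atTop := hV.trans inf_le_left
  have hex : ∀ n, ∃ M : (Fin n → Bool) → (Fin n → Bool) → Bool, IsStableComb (t + 1) c M ∧
      (¬ ((c : ℕ∞) < oracleCost 𝓜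
        (Matrix.of fun x y : Fin n → Bool => f (hammingDist x y))) →
        ∀ x y, M x y = f (hammingDist x y)) := by
    intro n
    by_cases hn : (c : ℕ∞) < oracleCost 𝓜
      (Matrix.of fun x y : Fin n → Bool => f (hammingDist x y))
    · exact ⟨_, isStableComb_const (by omega) c false, fun h => absurd hn h⟩
    · have hlt : oracleCost 𝓜 (Matrix.of fun x y : Fin n → Bool => f (hammingDist x y)) <
          ((c + 1 : ℕ) : ℕ∞) :=
        (not_lt.1 hn).trans_lt (by exact_mod_cast Nat.lt_succ_self c)
      simp only [oracleCost, iInf_lt_iff] at hlt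
      obtain ⟨T, hT, hTc⟩ := hlt
      have hTc' : T.cost ≤ c := Nat.lt_succ_iff.1 (by exact_mod_cast hTc)
      exact ⟨T.eval, isStableComb_oracleProtocol (by omega) (hQS _ _) c T hTc',
        fun _ x y => hT x y⟩
  choose M hM hMf using hex
  have hlim : ∀ k, (∀ᶠ z : WordPair in genericPair k, ∀ᶠ n in V,
      M n (oneHot n z.1) (oneHot n z.2) = true) ↔ f (2 * k) = true := by
    intro k
    have h1 : ∀ᶠ z : WordPair in genericPair k, ((∀ᶠ n in V,
        M n (oneHot n z.1) (oneHot n z.2) = true) ↔ f (2 * k) = true) := by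
      filter_upwards [eventually_genericPair_hammingDist k] with z hz
      have h2 : ∀ᶠ n in V, M n (oneHot n z.1) (oneHot n z.2) = f (2 * k) := by
        filter_upwards [hVtop hz, hV.trans inf_le_right (mem_principal_self _)] with n hn hn'
        rw [hMf n hn', hn]
      rw [eventually_congr (h2.mono fun n hn => by rw [hn]), eventually_const]
    rw [eventually_congr h1, eventually_const]
  have := eventually_isStableComb_iff V M hM
  rw [hlim, hlim] at this
  exact hf (Bool.eq_iff_iff.2 this.symm)

end Encoding

/-! ### A one-sided hashing protocol for threshold Hamming distance -/

section UpperBound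

/-- The protocol in which Alice sends `m` bits and Bob announces the output. -/
lemma exists_protocol {X Y : Type} (m : ℕ) (a : X → Fin m → Bool) (g : (Fin m → Bool) → Y → Bool) :
    ∃ T : Protocol X Y, T.cost ≤ m + 1 ∧ ∀ x y, T.eval x y = g (a x) y := by
  induction m with
  | zero =>
    refine ⟨.bob (g Fin.elim0) (.leaf false) (.leaf true), by simp [Protocol.cost], fun x y => ?_⟩
    rw [Subsingleton.elim (a x) Fin.elim0]
    simp [Protocol.eval]
  | succ m ih =>
    have h (b : Bool) := ih (fun x => Fin.tail (a x)) (fun v y => g (Fin.cons b v) y)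
    choose T hTc hT using h
    refine ⟨.alice (fun x => a x 0) (T false) (T true), ?_, fun x y => ?_⟩
    · have h1 := hTc false
      have h2 := hTc true
      simp only [Protocol.cost]
      omega
    · have h1 := Fin.cons_self_tail (a x)
      simp only [Protocol.eval, hT]
      split_ifs with h2
      · rw [← h2, h1]
      · rw [← Bool.eq_false_iff.2 h2, h1]

variable {n m : ℕ}

/-- The buckets that receive an odd number of elements of `D` under the hash function `h`. -/
def oddBuckets (h : Fin n → Fin m) (D : Finset (Fin n)) : Finset (Fin m) :=
  Finset.univ.filter fun v => Odd (D.filter fun i => h i = v).card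

lemma mem_oddBuckets {h : Fin n → Fin m} {D : Finset (Fin n)} {v : Fin m} :
    v ∈ oddBuckets h D ↔ Odd (D.filter fun i => h i = v).card := by
  simp [oddBuckets]

lemma card_oddBuckets_le (h : Fin n → Fin m) (D : Finset (Fin n)) :
    (oddBuckets h D).card ≤ D.card := by
  refine (Finset.card_le_card (t := D.image h) fun v hv => ?_).trans Finset.card_image_le
  obtain ⟨i, hi⟩ := Finset.card_pos.1 (mem_oddBuckets.1 hv).pos
  rw [Finset.mem_filter] at hi
  exact Finset.mem_image.2 ⟨i, hi.1, hi.2⟩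

lemma oddBuckets_update {h : Fin n → Fin m} {D : Finset (Fin n)} {s : Fin n} (hs : s ∉ D)
    (v : Fin m) : oddBuckets (Function.update h s v) D = oddBuckets h D := by
  ext u
  have h1 : (D.filter fun i => Function.update h s v i = u) = D.filter fun i => h i = u :=
    Finset.filter_congr fun i hi => by
      rw [Function.update_of_ne (ne_of_mem_of_not_mem hi hs)]
  rw [mem_oddBuckets, mem_oddBuckets, h1]

lemma card_filter_sdiff_add (h : Fin n → Fin m) {D S : Finset (Fin n)} (hS : S ⊆ D) (v : Fin m) :
    ((D \ S).filter fun i => h i = v).card + (S.filter fun i => h i = v).card =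
      (D.filter fun i => h i = v).card := by
  rw [← Finset.card_union_of_disjoint, ← Finset.filter_union, Finset.sdiff_union_of_subset hS]
  exact Finset.disjoint_filter_filter Finset.sdiff_disjoint

/-- If few buckets are odd, then some `s ∈ S` collides with an odd bucket of `D \ S` or with
another element of `S`. -/
lemma exists_collision {k : ℕ} {h : Fin n → Fin m} {D S : Finset (Fin n)} (hS : S ⊆ D)
    (hSk : S.card = k + 1) (hk : (oddBuckets h D).card ≤ k) :
    (oddBuckets h (D \ S)).card ≤ 2 * k + 1 ∧
      ∃ s ∈ S, h s ∈ oddBuckets h (D \ S) ∪ (S.erase s).image h := by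
  constructor
  · have h1 : oddBuckets h (D \ S) ⊆ oddBuckets h D ∪ S.image h := by
      intro v hv
      by_cases hvS : v ∈ S.image h
      · exact Finset.mem_union_right _ hvS
      · refine Finset.mem_union_left _ ?_
        have h2 := card_filter_sdiff_add h hS v
        have h3 : (S.filter fun i => h i = v).card = 0 := by
          rw [Finset.card_eq_zero, Finset.filter_eq_empty_iff]
          exact fun i hi hiv => hvS (Finset.mem_image.2 ⟨i, hi, hiv⟩)
        rw [mem_oddBuckets] at hv ⊢
        rwa [← h2, h3]
    have h2 := Finset.card_le_card h1
    have h3 := Finset.card_union_le (oddBuckets h D) (S.image h)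
    have h4 := Finset.card_image_le (s := S) (f := h)
    omega
  -- Without a collision, `S` is hashed injectively into even buckets of `D \ S`, and these `k + 1`
  -- buckets all become odd for `D`.
  · by_contra! hcon
    have hinj : Set.InjOn h S := by
      intro s hs s' hs' hss
      by_contra hne
      exact hcon s hs (Finset.mem_union_right _
        (Finset.mem_image.2 ⟨s', Finset.mem_erase.2 ⟨fun e => hne e.symm, hs'⟩, hss.symm⟩))
    have hsub : S.image h ⊆ oddBuckets h D := by
      intro v hv
      obtain ⟨s, hs, rfl⟩ := Finset.mem_image.1 hv
      have h1 : (S.filter fun i => h i = h s) = {s} := by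
        ext i
        simp only [Finset.mem_filter, Finset.mem_singleton]
        exact ⟨fun hi => hinj hi.1 hs hi.2, fun hi => by rw [hi]; exact ⟨hs, rfl⟩⟩
      have h2 : h s ∉ oddBuckets h (D \ S) := fun h' => hcon s hs (Finset.mem_union_left _ h')
      rw [mem_oddBuckets, Nat.not_odd_iff_even] at h2
      rw [mem_oddBuckets, ← card_filter_sdiff_add h hS, h1, Finset.card_singleton]
      exact h2.add_one
    have h1 := Finset.card_le_card hsub
    rw [Finset.card_image_of_injOn hinj] at h1
    omega

/-- A random value avoids, with high probability, a small set that is independent of it. -/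
lemma mul_card_filter_mem_le (s : Fin n) (R : (Fin n → Fin m) → Finset (Fin m)) (K : ℕ)
    (hR : ∀ h v, R (Function.update h s v) = R h) (hK : ∀ h, (R h).card ≤ K) :
    m * (Finset.univ.filter fun h : Fin n → Fin m => h s ∈ R h).card ≤
      K * Fintype.card (Fin n → Fin m) := by
  have h1 : ((Finset.univ : Finset (Fin m)) ×ˢ
      (Finset.univ.filter fun h : Fin n → Fin m => h s ∈ R h)).card ≤
      (Finset.univ.sigma R).card := by
    -- Resample `h s` as `v` and remember the old value, which still lies in `R` since `R` ignores
    -- `h s`.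
    refine Finset.card_le_card_of_injOn (fun p => ⟨Function.update p.2 s p.1, p.2 s⟩) ?_ ?_
    · rintro ⟨v, h⟩ hp
      simp only [Finset.coe_product, Set.mem_prod, Finset.mem_coe, Finset.mem_filter,
        Finset.mem_univ, true_and] at hp
      simpa [hR] using hp
    · rintro ⟨v, h⟩ _ ⟨v', h'⟩ _ he
      simp only [Sigma.mk.injEq, heq_eq_eq] at he
      obtain ⟨h1, h2⟩ := he
      have h3 := congrFun h1 s
      simp only [Function.update_self] at h3
      have h4 : h = h' := by
        have := congrArg (fun g => Function.update g s (h s)) h1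
        simp only [Function.update_idem] at this
        rw [Function.update_eq_self, h2, Function.update_eq_self] at this
        exact this
      rw [h3, h4]
  rw [Finset.card_product, Finset.card_sigma, Finset.card_univ, Fintype.card_fin] at h1
  refine h1.trans ((Finset.sum_le_card_nsmul _ _ K fun h _ => hK h).trans ?_)
  rw [smul_eq_mul, Finset.card_univ, mul_comm]

/-- The number of buckets of the hashing protocol for threshold `k`. -/
def numBuckets (k : ℕ) : ℕ := 3 * ((k + 1) * (3 * k + 1))

lemma three_mul_card_few_oddBuckets_le {k : ℕ} {D : Finset (Fin n)} (hD : k < D.card) :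
    3 * (Finset.univ.filter fun h : Fin n → Fin (numBuckets k) =>
      (oddBuckets h D).card ≤ k).card ≤ Fintype.card (Fin n → Fin (numBuckets k)) := by
  obtain ⟨S, hS, hSk⟩ := Finset.exists_subset_card_eq (n := k + 1) hD
  -- The set that `h s` must avoid, made independent of `h s`. Cutting it off to `∅` bounds its size
  -- by `(2 * k + 1) + k`. The union bound over the `k + 1` elements of `S` then explains
  -- `numBuckets`.
  let R : Fin n → (Fin n → Fin (numBuckets k)) → Finset (Fin (numBuckets k)) := fun s h =>
    if (oddBuckets h (D \ S)).card ≤ 2 * k + 1 then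
      oddBuckets h (D \ S) ∪ (S.erase s).image h else ∅
  have hRK : ∀ s ∈ S, ∀ h, (R s h).card ≤ 3 * k + 1 := by
    intro s hs h
    simp only [R]
    split_ifs with h1
    · have h2 := Finset.card_union_le (oddBuckets h (D \ S)) ((S.erase s).image h)
      have h3 := Finset.card_image_le (s := S.erase s) (f := h)
      rw [Finset.card_erase_of_mem hs] at h3
      omega
    · simp
  have hRu : ∀ s ∈ S, ∀ h v, R s (Function.update h s v) = R s h := by
    intro s hs h v
    have h1 : s ∉ D \ S := fun h' => (Finset.mem_sdiff.1 h').2 hs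
    have h2 : (S.erase s).image (Function.update h s v) = (S.erase s).image h :=
      Finset.image_congr fun i hi => Function.update_of_ne (Finset.ne_of_mem_erase hi) _ _
    simp only [R, oddBuckets_update h1, h2]
  have hsub : (Finset.univ.filter fun h : Fin n → Fin (numBuckets k) =>
      (oddBuckets h D).card ≤ k) ⊆ S.biUnion fun s => Finset.univ.filter fun h => h s ∈ R s h := by
    intro h hh
    rw [Finset.mem_filter] at hh
    obtain ⟨h1, s, hs, h2⟩ := exists_collision hS hSk hh.2
    refine Finset.mem_biUnion.2 ⟨s, hs, Finset.mem_filter.2 ⟨Finset.mem_univ _, ?_⟩⟩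
    simp only [R, if_pos h1]
    exact h2
  have h1 := (Finset.card_le_card hsub).trans Finset.card_biUnion_le
  have h2 : numBuckets k * ∑ s ∈ S, (Finset.univ.filter fun h => h s ∈ R s h).card ≤
      (k + 1) * ((3 * k + 1) * Fintype.card (Fin n → Fin (numBuckets k))) := by
    rw [Finset.mul_sum, ← hSk, ← smul_eq_mul (a := S.card)]
    exact Finset.sum_le_card_nsmul _ _ _ fun s hs =>
      mul_card_filter_mem_le s (R s) _ (hRu s hs) (hRK s hs)
  have h3 := (Nat.mul_le_mul_left (numBuckets k) h1).trans h2
  refine Nat.le_of_mul_le_mul_left (c := (k + 1) * (3 * k + 1)) ?_ (by positivity)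
  calc _ = numBuckets k * _ := by rw [numBuckets]; ring
    _ ≤ _ := h3
    _ = _ := by ring

/-- The parities of the numbers of ones of `x` in the buckets of `h`. -/
def bucketParity (h : Fin n → Fin m) (x : Fin n → Bool) (v : Fin m) : Bool :=
  decide (v ∈ oddBuckets h (Finset.univ.filter fun i => x i = true))

/-- Parity is additive modulo 2, and common ones of `x` and `y` cancel. Bob can therefore count the
odd buckets of the difference set from Alice's parities. -/
lemma filter_bucketParity_ne (h : Fin n → Fin m) (x y : Fin n → Bool) :
    (Finset.univ.filter fun v => bucketParity h x v ≠ bucketParity h y v) =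
      oddBuckets h (Finset.univ.filter fun i => x i ≠ y i) := by
  ext v
  simp only [bucketParity, ne_eq, decide_eq_decide, Finset.mem_filter, Finset.mem_univ, true_and,
    mem_oddBuckets, Finset.filter_filter]
  have h1 : (Finset.univ.filter fun i => x i = true ∧ h i = v).card +
      (Finset.univ.filter fun i => y i = true ∧ h i = v).card =
      (Finset.univ.filter fun i => ¬ x i = y i ∧ h i = v).card +
        2 * (Finset.univ.filter fun i => (x i = true ∧ y i = true) ∧ h i = v).card := by
    simp only [Finset.card_filter, Finset.mul_sum, ← Finset.sum_add_distrib]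
    refine Finset.sum_congr rfl fun i _ => ?_
    cases x i <;> cases y i <;> by_cases hi : h i = v <;> simp [hi]
  simp only [Nat.odd_iff]
  omega

/-- Threshold Hamming Distance, or its negation, has a one-sided error protocol of constant cost. -/
theorem oneSidedCost_threshold_le {X Y : Type} (b : Bool) (k : ℕ) (u : X → Fin n → Bool)
    (w : Y → Fin n → Bool) :
    oneSidedCost b (Matrix.of fun x y => decide (hammingDist (u x) (w y) ≤ k) == b) ≤
      ((numBuckets k + 1 : ℕ) : ℕ∞) := by
  have hT (h : Fin n → Fin (numBuckets k)) := exists_protocol (numBuckets k)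
    (fun x => bucketParity h (u x)) (fun v (y : Y) =>
      decide ((Finset.univ.filter fun i => v i ≠ bucketParity h (w y) i).card ≤ k) == b)
  choose T hTc hT using hT
  simp only [filter_bucketParity_ne] at hT
  have hne : Nonempty (Fin (numBuckets k)) := ⟨⟨0, by unfold numBuckets; positivity⟩⟩
  refine iInf₂_le _ ⟨(PMF.uniformOfFintype (Fin n → Fin (numBuckets k))).map T, ?_, ?_⟩
  · intro T' hT'
    rw [PMF.support_map] at hT'
    obtain ⟨h, -, rfl⟩ := hT'
    exact hTc h
  · intro x y
    simp only [Matrix.of_apply, outputProb, PMF.toOuterMeasure_map_apply]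
    constructor
    · intro hxy
      have hd : hammingDist (u x) (w y) ≤ k := by
        by_contra hd
        cases b <;> simp [hd] at hxy
      rw [PMF.toOuterMeasure_apply_eq_one_iff]
      intro h _
      have h1 := (card_oddBuckets_le h _).trans hd
      simp [hT, h1]
    · intro hxy
      have hd : k < hammingDist (u x) (w y) := by
        by_contra! hd
        cases b <;> simp [hd] at hxy
      have h1 := three_mul_card_few_oddBuckets_le hd
      have h2 := Finset.card_filter_add_card_filter_not (s := Finset.univ)
        (fun h : Fin n → Fin (numBuckets k) =>
          (oddBuckets h (Finset.univ.filter fun i => u x i ≠ w y i)).card ≤ k)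
      have h3 : T ⁻¹' {T' | T'.eval x y = !b} = ((Finset.univ.filter fun h =>
          ¬ (oddBuckets h (Finset.univ.filter fun i => u x i ≠ w y i)).card ≤ k :
            Finset (Fin n → Fin (numBuckets k))) : Set (Fin n → Fin (numBuckets k))) := by
        ext h
        simp only [Set.mem_preimage, Set.mem_ofPred_eq, hT, Finset.coe_filter, Finset.mem_univ,
          true_and]
        cases b <;> simp
      rw [h3, PMF.toOuterMeasure_uniformOfFintype_apply, ← Set.toFinset_card,
        Finset.toFinset_coe]
      rw [Finset.card_univ] at h2
      have hpos : 0 < Fintype.card (Fin n → Fin (numBuckets k)) := Fintype.card_pos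
      rw [ENNReal.le_div_iff_mul_le (Or.inl (by exact_mod_cast hpos.ne'))
        (Or.inl (ENNReal.natCast_ne_top _)), ← ENNReal.mul_div_right_comm]
      refine ENNReal.div_le_of_le_mul ?_
      have h4 : 2 * Fintype.card (Fin n → Fin (numBuckets k)) ≤
          (Finset.univ.filter fun h : Fin n → Fin (numBuckets k) =>
            ¬ (oddBuckets h (Finset.univ.filter fun i => u x i ≠ w y i)).card ≤ k).card * 3 := by
        simp only at h1
        omega
      exact_mod_cast h4

end UpperBound

/-! ### Bit-string matrices as submatrices of a communication problem -/

section Padding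

lemma exists_oracleProtocol_comap {𝓜 : Set BoolMatrix} {X Y X' Y' : Type} (u : X' → X)
    (w : Y' → Y) (T : OracleProtocol (QS 𝓜 X Y)) :
    ∃ T' : OracleProtocol (QS 𝓜 X' Y'), T'.cost = T.cost ∧
      ∀ x y, T'.eval x y = T.eval (u x) (w y) := by
  induction T with
  | leaf b => exact ⟨.leaf b, rfl, fun _ _ => rfl⟩
  | query Q l r ihl ihr =>
    obtain ⟨l', hlc, hl⟩ := ihl
    obtain ⟨r', hrc, hr⟩ := ihr
    obtain ⟨A, hA, f, g, hQ⟩ := Q.2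
    refine ⟨.query ⟨Q.1.submatrix u w, A, hA, f ∘ u, g ∘ w, by rw [hQ]; rfl⟩ l' r', ?_, ?_⟩
    · simp only [OracleProtocol.cost, hlc, hrc]
    · intro x y
      simp only [OracleProtocol.eval, hl, hr, Matrix.submatrix_apply]

lemma oracleCost_submatrix_le (𝓜 : Set BoolMatrix) {X Y X' Y' : Type} (u : X' → X) (w : Y' → Y)
    (P : Matrix X Y Bool) : oracleCost 𝓜 (P.submatrix u w) ≤ oracleCost 𝓜 P := by
  refine le_iInf₂ fun T hT => ?_
  obtain ⟨T', hc, hT'⟩ := exists_oracleProtocol_comap u w T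
  rw [← hc]
  exact iInf₂_le T' fun x y => by rw [hT', hT]; rfl

/-- Surjectivity makes the full matrix on bit strings a submatrix of the decoded `N × N` matrix. -/
lemma exists_surjective_bits (N : ℕ) :
    ∃ d : Fin N → (Fin (Nat.log 2 N) → Bool), N ≠ 0 → Function.Surjective d := by
  by_cases hN : N = 0
  · exact ⟨fun _ _ => false, fun h => absurd hN h⟩
  · have h1 : Fintype.card (Fin (Nat.log 2 N) → Bool) ≤ Fintype.card (Fin N) := by
      simpa using Nat.pow_log_le_self 2 hN
    obtain ⟨e⟩ := Function.Embedding.nonempty_of_card_le h1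
    exact ⟨Function.invFun e, fun _ => Function.invFun_surjective e.injective⟩

/-- Threshold Hamming Distance, or its negation, as a communication problem in the class of
problems with one-sided error. -/
theorem exists_oneSided_problem (b : Bool) (k : ℕ) :
    ∃ P ∈ OneSided0 b, ∀ n, ∃ N, ∀ 𝓜, oracleCost 𝓜
      (Matrix.of fun x y : Fin n → Bool => decide (hammingDist x y ≤ k) == b) ≤
        oracleCost 𝓜 (P N) := by
  choose d hd using exists_surjective_bits
  refine ⟨fun N => Matrix.of fun x y => decide (hammingDist (d N x) (d N y) ≤ k) == b,
    ⟨_, fun N => oneSidedCost_threshold_le b k (d N) (d N)⟩, fun n => ⟨2 ^ n, fun 𝓜 => ?_⟩⟩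
  suffices h : ∀ N, N ≠ 0 → ∀ n, Nat.log 2 N = n → oracleCost 𝓜
      (Matrix.of fun x y : Fin n → Bool => decide (hammingDist x y ≤ k) == b) ≤ oracleCost 𝓜
      (Matrix.of fun x y => decide (hammingDist (d N x) (d N y) ≤ k) == b) from
    h _ (by positivity) n (Nat.log_pow one_lt_two n)
  rintro N hN _ rfl
  have h1 := Function.rightInverse_surjInv (hd N hN)
  have h2 := oracleCost_submatrix_le 𝓜 (Function.surjInv (hd N hN)) (Function.surjInv (hd N hN))
    (Matrix.of fun x y => decide (hammingDist (d N x) (d N y) ≤ k) == b)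
  refine le_of_eq_of_le ?_ h2
  congr 1
  ext x y
  simp only [Matrix.of_apply, Matrix.submatrix_apply, h1 x, h1 y]

end Padding

/-! ### Absence of complete problems -/

section Main

lemma computes_of_computesOneSided {X Y : Type} {b : Bool} {μ : PMF (Protocol X Y)}
    {M : Matrix X Y Bool} (h : ComputesOneSided b μ M) : Computes μ M := by
  intro x y
  by_cases hM : M x y = b
  · rw [hM, (h x y).1 hM]
    exact ENNReal.div_le_of_le_mul (by norm_num)
  · have hM' : M x y = !b := by cases b <;> simpa using hM
    rw [hM']
    exact (h x y).2 hM'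

lemma randCost_le_oneSidedCost {X Y : Type} (b : Bool) (M : Matrix X Y Bool) :
    randCost M ≤ oneSidedCost b M :=
  le_iInf₂ fun c ⟨μ, hc, hμ⟩ => iInf₂_le c ⟨μ, hc, computes_of_computesOneSided hμ⟩

lemma oneSided0_subset_BPP0 (b : Bool) : OneSided0 b ⊆ BPP0 :=
  fun _ ⟨c, hc⟩ => ⟨c, fun N => (randCost_le_oneSidedCost b _).trans (hc N)⟩

/-- The matrices of a problem in `BPP⁰` do not contain large Greater-Than matrices. -/
lemma exists_not_hasStaircase_of_mem_BPP0 {Q : CommProblem} (hQ : Q ∈ BPP0) :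
    ∃ t, 1 ≤ t ∧ ∀ A ∈ Q.matrices, ¬ HasStaircase (t + 1) (fun x y => A.2 x y = true) := by
  obtain ⟨c, hc⟩ := hQ
  have h2 : 2 ≤ 2 ^ (200 * 4 ^ c) := Nat.le_self_pow (by positivity) 2
  refine ⟨2 ^ (200 * 4 ^ c) - 1, by omega, ?_⟩
  rw [Nat.sub_add_cancel (by omega)]
  rintro _ ⟨N, rfl⟩
  have hlt : randCost (Q N) < ((c + 1 : ℕ) : ℕ∞) :=
    (hc N).trans_lt (by exact_mod_cast Nat.lt_succ_self c)
  simp only [randCost, iInf_lt_iff] at hlt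
  obtain ⟨c', ⟨μ, hμc, hμ⟩, hc'⟩ := hlt
  have hc'' : c' ≤ c := Nat.lt_succ_iff.1 (by exact_mod_cast hc')
  exact not_hasStaircase_of_computes (fun T hT => (hμc T hT).trans hc'') hμ

theorem not_exists_complete {b : Bool} {𝓒 : Set CommProblem} (h1 : OneSided0 b ⊆ 𝓒)
    (h2 : 𝓒 ⊆ BPP0) : ¬ ∃ Q, IsCompleteFor 𝓒 Q := by
  rintro ⟨Q, hQ, hcomp⟩
  obtain ⟨t, ht, hst⟩ := exists_not_hasStaircase_of_mem_BPP0 (h2 hQ)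
  obtain ⟨P, hP, hPle⟩ := exists_oneSided_problem b (2 * t)
  obtain ⟨c, hc⟩ := hcomp P (h1 hP)
  have h3 := isOmegaOne_oracleCost_of_not_hasStaircase ht hst
    (fun d => decide (d ≤ 2 * t) == b) (by cases b <;> simp) c
  obtain ⟨n, hn⟩ := h3.exists
  obtain ⟨N, hN⟩ := hPle n
  exact absurd ((hN Q.matrices).trans (hc N)) (not_le.2 hn)

end Main

end ConstantCost

theorem theorem1 :
    (∀ Q ∈ BPP0, ∃ k : ℕ,
      IsOmegaOne (fun n => oracleCost Q.matrices (EHD k n)) ∧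
      IsOmegaOne (fun n => oracleCost Q.matrices (THD k n))) ∧
    (¬ ∃ Q, IsCompleteFor BPP0 Q) ∧
    (∀ b : Bool, ¬ ∃ Q, IsCompleteFor (OneSided0 b) Q) := by
  refine ⟨fun Q hQ => ?_, not_exists_complete (oneSided0_subset_BPP0 true) subset_rfl,
    fun b => not_exists_complete subset_rfl (oneSided0_subset_BPP0 b)⟩
  obtain ⟨t, ht, hst⟩ := exists_not_hasStaircase_of_mem_BPP0 hQ
  exact ⟨2 * t,
    isOmegaOne_oracleCost_of_not_hasStaircase ht hst (fun d => decide (d = 2 * t)) (by simp),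
    isOmegaOne_oracleCost_of_not_hasStaircase ht hst (fun d => decide (d ≤ 2 * t)) (by simp)⟩
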